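/- Let $(i,H,B)$ be an abstract Wiener space: $H$ is a real separable Hilbert space with scalar product $a\cdot b$ and norm $|\cdot|$, $B$ is a real Banach space, and $i:H\to B$ is a continuous linear injection with dense range such that the norm of $B$ is measurable in the sense of Gross (for all $\varepsilon,h>0$ there is a finite-dimensional subspace $K\subset H$ such that $\mu_{E,h}(\{x\in E:\|i(x)\|_B>\varepsilon\})<\varepsilon$ for every finite-dimensional subspace $E\subset H$ orthogonal to $K$, where $d\mu_{E,h}(x)=(2\pi h)^{-\dim E/2}e^{-|x|^2/(2h)}\,dx$). Through $i$ one regards $B'\subset H'=H\subset B$. The space $H^2$ carries the norm $|(x,\xi)|^2=|x|^2+|\xi|^2$, and $H^2\subset B^2$ via $(x,\xi)\mapsto(i(x),i(\xi))$. For $h>0$, $\mu_{B^2,h}$ is the Borel probability measure on $B^2$ under which every finite system $u_1,\dots,u_n\in (B^2)'$ that is orthonormal in $H^2$ has law $\mu_{\mathbb R^n,h}$. For $u\in H^2$, $\ell_u\in L^2(B^2,\mu_{B^2,h})$ is the image of $u$ under the continuous extension to $H^2$ of the inclusion $(B^2)'\subset L^2(B^2,\mu_{B^2,h})$. For a finite-dimensional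 subspace $E\subset H^2$ with orthonormal basis $(u_k)$ put $\widetilde\pi_E(X)=\sum_k\ell_{u_k}(X)u_k$ (defined for $\mu_{B^2,h}$-almost every $X\in B^2$). A Borel function $\widetilde F$ on $B^2$ is a *stochastic extension* of a Borel function $F:H^2\to\mathbb C$ with respect to $\mu_{B^2,h}$ if, for every increasing sequence $(E_n)$ of finite-dimensional subspaces of $H^2$ with dense union, $F\circ\widetilde\pi_{E_n}\to\widetilde F$ in probability with respect to $\mu_{B^2,h}$. It is a *stochastic extension in $L^1(B^2,\mu_{B^2,h})$* if $\widetilde F\in L^1(B^2,\mu_{B^2,h})$ and, for every such sequence, $F\circ\widetilde\pi_{E_n}\in L^1(B^2,\mu_{B^2,h})$ for all $n$ and $F\circ\widetilde\pi_{E_n}\to\widetilde F$ in $L^1(B^2,\mu_{B^2,h})$. Let $(e_j)_{j\in\Gamma}$ be a Hilbert basis of $H$ with $\Gamma$ countable, and put $u_j=(e_j,0)$, $v_j=(0,e_j)$. For an integer $m\ge0$, a real $M\ge0$ and a family $\varepsilon=(\varepsilon_j)_{j\in\Gamma}$ of nonnegative reals, $S_m(M,\varepsilon)$ is the set of bounded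 continuous $F:H^2\to\mathbb C$ such that, for all finitely supported $\alpha,\beta:\Gamma\to\mathbb N$ with $\alpha_j\le m$ and $\beta_j\le m$ for all $j$, the derivative $\bigl[\prod_j\partial_{u_j}^{\alpha_j}\partial_{v_j}^{\beta_j}\bigr]F$ is well defined and continuous on $H^2$ and is bounded in absolute value by $M\prod_j\varepsilon_j^{\alpha_j+\beta_j}$. For $F:H^2\to\mathbb C$ and $h>0$ consider the hypotheses * (H1) $F\in S_2(M,\varepsilon)$ and $\varepsilon$ is square summable; * (H2) there is a function $\widetilde F$ on $B^2$ which is a stochastic extension of $F$ with respect to both $\mu_{B^2,h}$ and $\mu_{B^2,h/2}$. **Proposition 8.7.** Let $F\in S_1(M,\varepsilon)$, where the family $\varepsilon$ is summable. Then, for every $h>0$, $F$ admits a stochastic extension in $L^1(B^2,\mu_{B^2,h})$; moreover, for every $h>0$, $F$ satisfies (H2). In particular, if $\varepsilon$ is summable, then (H1) implies (H2) for every $h>0$. -/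

import Mathlib

open MeasureTheory ProbabilityTheory Filter Topology

noncomputable section

namespace WienerWeyl

/-- The Gaussian measure `μ_{ℝⁿ,h}` with density `(2πh)^{-n/2} exp(-|t|²/(2h))`, written as the
product of `n` centred one-dimensional Gaussian measures of variance `h`. Through an orthonormal
basis it is the Gaussian measure `μ_{E,h}` of an `n`-dimensional Euclidean space `E`. -/
def gaussianFin (n : ℕ) (h : ℝ) : Measure (Fin n → ℝ) :=
  Measure.pi fun _ => gaussianReal 0 h.toNNReal

section General

variable {H B : Type*} [NormedAddCommGroup H] [InnerProductSpace ℝ H]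
  [NormedAddCommGroup B] [NormedSpace ℝ B]

/-- `(i, H, B)` is an abstract Wiener space: `i` is a continuous linear injection with dense range
and the norm of `B` is measurable in the sense of Gross. A finite-dimensional subspace `E`
orthogonal to `K` is given by an orthonormal basis `v` of it, and `μ_{E,h}` by coordinates. -/
structure IsAbstractWienerSpace (i : H →L[ℝ] B) : Prop where
  injective : Function.Injective i
  denseRange : DenseRange i
  measurable_norm : ∀ ε h : ℝ, 0 < ε → 0 < h →
    ∃ K : Submodule ℝ H, FiniteDimensional ℝ K ∧
      ∀ (n : ℕ) (v : Fin n → H), Orthonormal ℝ v → (∀ k, v k ∈ Kᗮ) →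
        gaussianFin n h {t | ε < ‖i (∑ k, t k • v k)‖} < ENNReal.ofReal ε

/-- The inclusion `B' ⊂ H' = H`: the functional `f ∈ B'` restricts on `H` to `x ↦ u · x`. -/
def Represents (i : H →L[ℝ] B) (f : B →L[ℝ] ℝ) (u : H) : Prop :=
  ∀ x : H, f (i x) = inner ℝ u x

variable [MeasurableSpace B]

/-- `μ` is a Borel measure on `B` that extends the Gaussian cylinder set function of parameter `h`:
a finite system of elements of `B'` that is orthonormal in `H` has the law `μ_{ℝⁿ,h}`. -/
structure IsWienerMeasure (i : H →L[ℝ] B) (h : ℝ) (μ : Measure B) : Prop where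
  isProbabilityMeasure : IsProbabilityMeasure μ
  map_eq : ∀ (n : ℕ) (f : Fin n → B →L[ℝ] ℝ) (u : Fin n → H), Orthonormal ℝ u →
    (∀ k, Represents i (f k) (u k)) → μ.map (fun x k => f k x) = gaussianFin n h

open Classical in
/-- The measure `μ_{B,h}`: the (unique) extension of the Gaussian cylinder set function to a Borel
measure on `B`. It exists for all `h > 0` when `(i, H, B)` is an abstract Wiener space. -/
def wienerMeasure (i : H →L[ℝ] B) (h : ℝ) : Measure B :=
  if hμ : ∃ μ : Measure B, IsWienerMeasure i h μ then hμ.choose else 0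

/-- `g` is a version of `ℓ_u`, the image of `u ∈ H` under the continuous extension to `H` of the
inclusion of `B'` into `L²(B, μ)`: it is an `L²`-limit of functionals `f n ∈ B'`
that converge to `u` in `H`. -/
def IsEll (i : H →L[ℝ] B) (μ : Measure B) (u : H) (g : B → ℝ) : Prop :=
  MemLp g 2 μ ∧ ∃ (f : ℕ → B →L[ℝ] ℝ) (a : ℕ → H),
    (∀ n, Represents i (f n) (a n)) ∧ Tendsto a atTop (𝓝 u) ∧
      Tendsto (fun n => eLpNorm (fun x => f n x - g x) 2 μ) atTop (𝓝 0)

open Classical in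
/-- A version of the function `ℓ_u` (which is defined up to `μ`-almost everywhere equality). -/
def ell (i : H →L[ℝ] B) (μ : Measure B) (u : H) : B → ℝ :=
  if hg : ∃ g : B → ℝ, IsEll i μ u g then hg.choose else 0

/-- The map `π̃_E : B → E ⊂ H`, `π̃_E(x) = ∑ ℓ_{u_k}(x) u_k` for an orthonormal basis `(u_k)` of the
finite-dimensional subspace `E` of `H`; up to almost everywhere equality it does not depend on the
choice of the basis. -/
def piTilde (i : H →L[ℝ] B) (μ : Measure B) (E : Submodule ℝ H) [FiniteDimensional ℝ E]
    (x : B) : H :=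
  ∑ k, ell i μ (stdOrthonormalBasis ℝ E k : H) x • (stdOrthonormalBasis ℝ E k : H)

/-- The Borel function `f'` is a stochastic extension of the Borel function `f` with respect to
`μ`: convergence in probability along every increasing sequence of finite-dimensional subspaces
with dense union. -/
def IsStochasticExtension (i : H →L[ℝ] B) (μ : Measure B) (f : H → ℂ) (f' : B → ℂ) : Prop :=
  Measurable[borel H] f ∧ Measurable f' ∧
    ∀ (E : ℕ → Submodule ℝ H) [∀ n, FiniteDimensional ℝ (E n)],
      Monotone E → Dense (⋃ n, (E n : Set H)) →
        TendstoInMeasure μ (fun n x => f (piTilde i μ (E n) x)) atTop f'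

/-- `f'` is a stochastic extension of `f` in the sense of `Lᵖ(B, μ)`. -/
def IsStochasticExtensionLp (p : ENNReal) (i : H →L[ℝ] B) (μ : Measure B)
    (f : H → ℂ) (f' : B → ℂ) : Prop :=
  MemLp f' p μ ∧
    ∀ (E : ℕ → Submodule ℝ H) [∀ n, FiniteDimensional ℝ (E n)],
      Monotone E → Dense (⋃ n, (E n : Set H)) →
        (∀ n, MemLp (fun x => f (piTilde i μ (E n) x)) p μ) ∧
        Tendsto (fun n => eLpNorm (fun x => f (piTilde i μ (E n) x) - f' x) p μ) atTop (𝓝 0)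

end General

section PhaseSpace

/-- The phase space `H²` with the Hilbert norm `|(x,ξ)|² = |x|² + |ξ|²`. -/
abbrev Phase (H : Type*) : Type _ := WithLp 2 (H × H)

variable {H B Γ : Type*} [NormedAddCommGroup H] [InnerProductSpace ℝ H]
  [NormedAddCommGroup B] [NormedSpace ℝ B]

/-- The injection `H² → B²`, `(x, ξ) ↦ (i x, i ξ)`. -/
def phaseIncl (i : H →L[ℝ] B) : Phase H →L[ℝ] B × B :=
  (i.prodMap i).comp (WithLp.prodContinuousLinearEquiv 2 ℝ H H : Phase H →L[ℝ] H × H)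

/-- The class `S_m(M, ε)` with respect to the Hilbert basis `e`. The function `D α β` is the
derivative `∂_u^α ∂_v^β F`, where `u_j = (e_j, 0)` and `v_j = (0, e_j)`. -/
structure InSClass (e : HilbertBasis Γ ℝ H) (m : ℕ) (M : ℝ) (ε : Γ → ℝ) (F : Phase H → ℂ) :
    Prop where
  M_nonneg : 0 ≤ M
  ε_nonneg : ∀ j, 0 ≤ ε j
  continuous : Continuous F
  bounded : ∃ C : ℝ, ∀ X, ‖F X‖ ≤ C
  derivatives : ∃ D : (Γ →₀ ℕ) → (Γ →₀ ℕ) → Phase H → ℂ,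
    D 0 0 = F ∧
    (∀ α β : Γ →₀ ℕ, (∀ j, α j ≤ m) → (∀ j, β j ≤ m) →
      Continuous (D α β) ∧ ∀ X, ‖D α β X‖ ≤ M * (α + β).prod fun j k => ε j ^ k) ∧
    (∀ (α β : Γ →₀ ℕ) (l : Γ), (∀ j, α j ≤ m) → (∀ j, β j ≤ m) → α l < m →
      ∀ X, HasLineDerivAt ℝ (D α β) (D (α + Finsupp.single l 1) β X) X
        (WithLp.toLp 2 (e l, (0 : H)))) ∧
    (∀ (α β : Γ →₀ ℕ) (l : Γ), (∀ j, α j ≤ m) → (∀ j, β j ≤ m) → β l < m →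
      ∀ X, HasLineDerivAt ℝ (D α β) (D α (β + Finsupp.single l 1) X) X
        (WithLp.toLp 2 ((0 : H), e l)))

/-- Hypothesis (H1): `F ∈ S_2(M, ε)` with `ε` square summable. -/
def HypothesisH1 (e : HilbertBasis Γ ℝ H) (M : ℝ) (ε : Γ → ℝ) (F : Phase H → ℂ) : Prop :=
  InSClass e 2 M ε F ∧ Summable fun j => ε j ^ 2

/-- Hypothesis (H2): some function on `B²` is a stochastic extension of `F` with respect to both
`μ_{B²,h}` and `μ_{B²,h/2}`. -/
def HypothesisH2 [MeasurableSpace B] (i : H →L[ℝ] B) (h : ℝ) (F : Phase H → ℂ) : Prop :=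
  ∃ F' : B × B → ℂ,
    IsStochasticExtension (phaseIncl i) (wienerMeasure (phaseIncl i) h) F F' ∧
    IsStochasticExtension (phaseIncl i) (wienerMeasure (phaseIncl i) (h / 2)) F F'

end PhaseSpace

end WienerWeyl

end

open scoped ENNReal

noncomputable section

namespace WienerWeyl

/-! ### Functionals of `B'` and the variables `ℓ_u` under a Wiener measure. -/

section Functionals

variable {H B : Type*} [NormedAddCommGroup H] [InnerProductSpace ℝ H]
  [NormedAddCommGroup B] [NormedSpace ℝ B] {i : H →L[ℝ] B} {h : ℝ}

/-! Let `w` be the basis of `H²` made of the `u_j` and `v_j`. Changing one coordinate at a time and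
using continuity, `F` satisfies `|F X - F Y| ≤ ∑ δ_j |w_j · (X - Y)|`, where `δ_j` is `M ε_l` for
`w_j = u_l` or `v_l`, a summable family (`InSClass.isCoordLipschitz`).

The component of `π̃_E` along `w_j` is a version of `ℓ_a` with `a` the projection of `w_j` onto `E`.
For random vectors `P`, `P'` with components `ℓ_{A j}`, `ℓ_{A' j}`, the L¹ norm of `ℓ_{A j - A' j}`
is at most its L² norm, a constant depending only on `h` times `|A j - A' j|`. Hence `F ∘ P` and `F
∘ P'` are close in L¹ once `∑ δ_j |A j - w_j|` and its analogue for `A'` are small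
(`eLpNorm_comp_sub_comp_le`). For projections onto increasing subspaces with dense union this sum
tends to 0 by dominated convergence.

(H2) asks for one function serving two measures, whereas versions of `ℓ_u` depend on the measure.
The reference sequence is therefore built from genuine functionals in `B'` close to the `w_j`; it is
Cauchy in L¹ of the sum of the two measures, and its limit is the extension for both.

Since `wienerMeasure` is 0 when no Wiener measure exists, Gross's existence theorem is also needed:
a random series over a basis adapted to the measurable norm converges almost surely, and its law is
the measure on `B`; its square lives on `B²`. -/

lemma Represents.smul {f : B →L[ℝ] ℝ} {u : H} (hf : Represents i f u) (c : ℝ) :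
    Represents i (c • f) (c • u) := fun x => by
  simp [hf x, inner_smul_left]

lemma Represents.add {f g : B →L[ℝ] ℝ} {u v : H} (hf : Represents i f u)
    (hg : Represents i g v) : Represents i (f + g) (u + v) := fun x => by
  simp [hf x, hg x, inner_add_left]

lemma Represents.sub {f g : B →L[ℝ] ℝ} {u v : H} (hf : Represents i f u)
    (hg : Represents i g v) : Represents i (f - g) (u - v) := fun x => by
  simp [hf x, hg x, inner_sub_left]

lemma represents_zero : Represents i (0 : B →L[ℝ] ℝ) 0 := fun x => by simp

lemma Represents.sum {ι : Type*} (s : Finset ι) {f : ι → B →L[ℝ] ℝ} {u : ι → H}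
    (hf : ∀ k, Represents i (f k) (u k)) : Represents i (∑ k ∈ s, f k) (∑ k ∈ s, u k) :=
  fun x => by simp [hf _ x, sum_inner]

lemma Represents.eq_zero (hd : DenseRange i) {f : B →L[ℝ] ℝ} (hf : Represents i f 0) :
    f = 0 := by
  have := hd.equalizer f.continuous continuous_zero (funext fun x => by simp [hf x])
  ext x
  exact congrFun this x

lemma exists_represents [CompleteSpace H] (f : B →L[ℝ] ℝ) : ∃ u : H, Represents i f u :=
  ⟨(InnerProductSpace.toDual ℝ H).symm (f.comp i), fun x => by
    rw [InnerProductSpace.toDual_symm_apply]; rfl⟩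

/-- `B'` is dense in `H`. -/
lemma dense_represents [CompleteSpace H] (hi : Function.Injective i) :
    Dense {u : H | ∃ f : B →L[ℝ] ℝ, Represents i f u} := by
  let S : Submodule ℝ H :=
    { carrier := {u : H | ∃ f : B →L[ℝ] ℝ, Represents i f u}
      add_mem' := fun ⟨f, hf⟩ ⟨g, hg⟩ => ⟨f + g, hf.add hg⟩
      zero_mem' := ⟨0, represents_zero⟩
      smul_mem' := fun c _ ⟨f, hf⟩ => ⟨c • f, hf.smul c⟩ }
  change Dense (S : Set H)
  rw [Submodule.dense_iff_topologicalClosure_eq_top, Submodule.topologicalClosure_eq_top_iff,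
    Submodule.eq_bot_iff]
  intro x hx
  -- A vector orthogonal to every element of `B'` is sent by `i` to a point killed by all of `B'`,
  -- and functionals separate points.
  have h0 : i x = 0 := by
    refine SeparatingDual.eq_zero_of_forall_dual_eq_zero (R := ℝ) fun f => ?_
    obtain ⟨u, hu⟩ := exists_represents (i := i) f
    rw [hu x]
    exact (Submodule.mem_orthogonal S x).1 hx u ⟨f, hu⟩
  exact hi (by simpa using h0)

variable [MeasurableSpace B] [BorelSpace B] {μ : Measure B}

/-- A functional in `B'` that represents `u` is a centred Gaussian variable of variance
`h * |u|²`. -/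
lemma IsWienerMeasure.map_eq_gaussianReal (hμ : IsWienerMeasure i h μ) (hd : DenseRange i)
    {f : B →L[ℝ] ℝ} {u : H} (hf : Represents i f u) :
    μ.map f = (gaussianReal 0 h.toNNReal).map (fun t => ‖u‖ * t) := by
  have := hμ.isProbabilityMeasure
  -- The defining property speaks of unit vectors only. The vector 0 cannot be normalised; there
  -- density of the range forces `f = 0`, and both laws are Dirac masses.
  rcases eq_or_ne u 0 with rfl | hu
  · rw [hf.eq_zero hd]
    have h1 : ((0 : B →L[ℝ] ℝ) : B → ℝ) = fun _ => 0 := rfl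
    have h2 : (fun t : ℝ => ‖(0 : H)‖ * t) = fun _ => 0 := by simp
    rw [h1, h2, Measure.map_const, Measure.map_const]
    simp
  · have hn : ‖u‖ ≠ 0 := norm_ne_zero_iff.2 hu
    have key := hμ.map_eq 1 (fun _ => ‖u‖⁻¹ • f) (fun _ => ‖u‖⁻¹ • u)
      ⟨fun _ => by simp [norm_smul, hn], fun a b hab => (hab (Subsingleton.elim a b)).elim⟩
      (fun _ => hf.smul _)
    have h3 : (gaussianFin 1 h).map (fun t => t 0) = gaussianReal 0 h.toNNReal := by
      unfold gaussianFin
      exact (measurePreserving_eval (fun _ : Fin 1 => gaussianReal 0 h.toNNReal) 0).map_eq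
    rw [← h3, ← key, Measure.map_map (by fun_prop) (by fun_prop),
      Measure.map_map (by fun_prop) (by fun_prop)]
    congr 1
    ext x
    simp [hn]

/-- A Wiener measure is characterized by its one-dimensional laws. -/
lemma isWienerMeasure_of_map_eq [IsProbabilityMeasure μ]
    (hμ : ∀ (f : B →L[ℝ] ℝ) (u : H), Represents i f u →
      charFun (μ.map f) 1 = Complex.exp (-(h.toNNReal * ‖u‖ ^ 2 / 2 : ℝ))) :
    IsWienerMeasure i h μ := by
  refine ⟨inferInstance, fun n f u hu hf => ?_⟩
  have : IsProbabilityMeasure (μ.map fun x k => f k x) :=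
    Measure.isProbabilityMeasure_map (by fun_prop)
  unfold gaussianFin
  rw [← charFun_eq_pi_iff]
  intro t
  have hr := Represents.sum Finset.univ (fun k => (hf k).smul (t k))
  have h1 := hμ _ _ hr
  have hnorm : ‖∑ k, t k • u k‖ ^ 2 = ∑ k, t k ^ 2 := by
    rw [← real_inner_self_eq_norm_sq, hu.inner_sum]
    simp [sq]
  rw [hnorm] at h1
  simp_rw [charFun_gaussianReal]
  rw [← Complex.exp_sum]
  have h2 : charFun ((μ.map fun x k => f k x).map (WithLp.toLp 2)) t =
      charFun (μ.map (∑ k, t k • f k : B →L[ℝ] ℝ)) 1 := by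
    rw [charFun_apply, charFun_apply, integral_map (by fun_prop)
      (Measurable.aestronglyMeasurable (by fun_prop)), integral_map (by fun_prop)
      (Measurable.aestronglyMeasurable (by fun_prop)), integral_map (by fun_prop)
      (Measurable.aestronglyMeasurable (by fun_prop))]
    simp [PiLp.inner_apply, mul_comm]
  rw [h2, h1]
  congr 1
  push_cast
  rw [Finset.mul_sum, Finset.sum_div, ← Finset.sum_neg_distrib]
  refine Finset.sum_congr rfl fun k _ => ?_
  simp

/-- The `L²` norm of a centred Gaussian variable of variance `h`. -/
def gaussianNorm (h : ℝ) : ℝ≥0∞ := eLpNorm id 2 (gaussianReal 0 h.toNNReal)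

lemma gaussianNorm_ne_top (h : ℝ) : gaussianNorm h ≠ ∞ :=
  (memLp_id_gaussianReal' 2 (by simp)).eLpNorm_ne_top

lemma IsWienerMeasure.eLpNorm_eq (hμ : IsWienerMeasure i h μ) (hd : DenseRange i)
    {f : B →L[ℝ] ℝ} {u : H} (hf : Represents i f u) :
    eLpNorm f 2 μ = ‖u‖ₑ * gaussianNorm h := by
  have h1 : eLpNorm f 2 μ = eLpNorm id 2 (μ.map f) := by
    rw [eLpNorm_map_measure aestronglyMeasurable_id (by fun_prop)]
    rfl
  rw [h1, hμ.map_eq_gaussianReal hd hf, eLpNorm_map_measure aestronglyMeasurable_id (by fun_prop)]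
  have h2 : (id ∘ fun t : ℝ => ‖u‖ * t) = ‖u‖ • (id : ℝ → ℝ) := by
    ext; simp
  rw [h2, eLpNorm_const_smul]
  simp [gaussianNorm]

lemma IsWienerMeasure.memLp (hμ : IsWienerMeasure i h μ) (hd : DenseRange i)
    {f : B →L[ℝ] ℝ} {u : H} (hf : Represents i f u) : MemLp f 2 μ :=
  ⟨f.continuous.measurable.aestronglyMeasurable, by
    rw [hμ.eLpNorm_eq hd hf]
    exact ENNReal.mul_lt_top (by simp) (gaussianNorm_ne_top h).lt_top⟩

lemma Represents.isEll (hμ : IsWienerMeasure i h μ) (hd : DenseRange i)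
    {f : B →L[ℝ] ℝ} {u : H} (hf : Represents i f u) : IsEll i μ u f :=
  ⟨hμ.memLp hd hf, fun _ => f, fun _ => u, fun _ => hf, tendsto_const_nhds, by simp⟩

/-- The isometry, up to a constant, passes from `B'` to `L²` limits. Applied to differences, it
controls `ℓ_u - ℓ_v` by `|u - v|` whatever versions are chosen. -/
lemma IsEll.eLpNorm_eq (hμ : IsWienerMeasure i h μ) (hd : DenseRange i) {u : H} {g : B → ℝ}
    (hg : IsEll i μ u g) : eLpNorm g 2 μ = ‖u‖ₑ * gaussianNorm h := by
  obtain ⟨hg2, f, a, hf, ha, hlim⟩ := hg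
  have h1 : Tendsto (fun n => eLpNorm (f n) 2 μ) atTop (𝓝 (eLpNorm g 2 μ)) := by
    have hmem : ∀ n, MemLp (f n) 2 μ := fun n => hμ.memLp hd (hf n)
    have := (Lp.tendsto_Lp_iff_tendsto_eLpNorm'' (fun n => ⇑(f n)) hmem g hg2).2 hlim
    have := ((continuous_enorm.tendsto _).comp this)
    simpa [Function.comp_def, Lp.enorm_toLp] using this
  have h2 : Tendsto (fun n => eLpNorm (f n) 2 μ) atTop (𝓝 (‖u‖ₑ * gaussianNorm h)) := by
    simp_rw [fun n => hμ.eLpNorm_eq hd (hf n)]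
    exact ENNReal.Tendsto.mul_const ((continuous_enorm.tendsto _).comp ha)
      (Or.inr (gaussianNorm_ne_top h))
  exact tendsto_nhds_unique h1 h2

lemma IsEll.add {u v : H} {g k : B → ℝ} (hg : IsEll i μ u g) (hk : IsEll i μ v k) :
    IsEll i μ (u + v) (fun x => g x + k x) := by
  obtain ⟨hg2, f, a, hf, ha, hlim⟩ := hg
  obtain ⟨hk2, f', a', hf', ha', hlim'⟩ := hk
  refine ⟨hg2.add hk2, fun n => f n + f' n, fun n => a n + a' n, fun n => (hf n).add (hf' n),
    ha.add ha', ?_⟩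
  refine tendsto_of_tendsto_of_tendsto_of_le_of_le tendsto_const_nhds
    (by simpa using hlim.add hlim') (fun _ => zero_le) fun n => ?_
  have e : (fun x => (f n + f' n) x - (g x + k x)) =
      (fun x => f n x - g x) + fun x => f' n x - k x := by
    ext x; simp; ring
  simp only [e]
  exact eLpNorm_add_le ((f n).continuous.measurable.aestronglyMeasurable.sub hg2.1)
    ((f' n).continuous.measurable.aestronglyMeasurable.sub hk2.1) (by norm_num)

lemma IsEll.smul {u : H} {g : B → ℝ} (hg : IsEll i μ u g) (c : ℝ) :
    IsEll i μ (c • u) (fun x => c * g x) := by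
  obtain ⟨hg2, f, a, hf, ha, hlim⟩ := hg
  refine ⟨hg2.const_mul c, fun n => c • f n, fun n => c • a n, fun n => (hf n).smul c,
    ha.const_smul c, ?_⟩
  have e : ∀ n, eLpNorm (fun x => (c • f n) x - c * g x) 2 μ =
      ‖c‖ₑ * eLpNorm (fun x => f n x - g x) 2 μ := fun n => by
    rw [← eLpNorm_const_smul]
    congr 1
    ext x; simp; ring
  simp_rw [e]
  simpa using ENNReal.Tendsto.const_mul hlim (Or.inr (by simp))

lemma isEll_zero : IsEll i μ (0 : H) (fun _ => 0) :=
  ⟨MemLp.zero', fun _ => 0, fun _ => 0, fun _ => represents_zero, tendsto_const_nhds, by simp⟩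

lemma IsEll.sub {u v : H} {g k : B → ℝ} (hg : IsEll i μ u g) (hk : IsEll i μ v k) :
    IsEll i μ (u - v) (fun x => g x - k x) := by
  have := hg.add (hk.smul (-1))
  simpa [sub_eq_add_neg] using this

lemma IsEll.sum {ι : Type*} (s : Finset ι) {u : ι → H} {g : ι → B → ℝ}
    (hg : ∀ k, IsEll i μ (u k) (g k)) :
    IsEll i μ (∑ k ∈ s, u k) (fun x => ∑ k ∈ s, g k x) := by
  classical
  induction s using Finset.induction_on with
  | empty => simpa using isEll_zero
  | insert a s ha ih =>
    simp only [Finset.sum_insert ha]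
    exact (hg a).add ih

/-- The functions `ℓ_u` exist. -/
lemma exists_isEll [CompleteSpace H] (hi : Function.Injective i) (hd : DenseRange i)
    (hμ : IsWienerMeasure i h μ) (u : H) : ∃ g : B → ℝ, IsEll i μ u g := by
  obtain ⟨a, hmem, ha⟩ := mem_closure_iff_seq_limit.1 (dense_represents hi u)
  choose f hf using hmem
  have hm : ∀ n, MemLp (f n) 2 μ := fun n => hμ.memLp hd (hf n)
  have hnorm : ∀ n m, edist ((hm n).toLp) ((hm m).toLp) = edist (a n) (a m) * gaussianNorm h := by
    intro n m
    rw [Lp.edist_toLp_toLp, edist_eq_enorm_sub, ← hμ.eLpNorm_eq hd ((hf n).sub (hf m))]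
    rfl
  have hc : CauchySeq fun n => (hm n).toLp := by
    rw [EMetric.cauchySeq_iff]
    intro δ hδ
    have hC := gaussianNorm_ne_top h
    -- The added 1 avoids division by zero: `gaussianNorm h` vanishes when `h ≤ 0`.
    obtain ⟨N, hN⟩ := EMetric.cauchySeq_iff.1 ha.cauchySeq (δ / (gaussianNorm h + 1))
      (ENNReal.div_pos hδ.ne' (by simp [hC]))
    refine ⟨N, fun n hn m hm' => ?_⟩
    rw [hnorm]
    have h1 := hN n hn m hm'
    rw [ENNReal.lt_div_iff_mul_lt (by simp) (by simp [hC])] at h1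
    refine lt_of_le_of_lt ?_ h1
    gcongr
    exact le_self_add
  obtain ⟨g, hg⟩ := cauchySeq_tendsto_of_complete hc
  refine ⟨g, Lp.memLp g, f, a, hf, ha, ?_⟩
  refine (Lp.tendsto_Lp_iff_tendsto_eLpNorm'' (fun n => ⇑(f n)) hm g (Lp.memLp g)).1 ?_
  simpa using hg

lemma isEll_ell [CompleteSpace H] (hi : Function.Injective i) (hd : DenseRange i)
    (hμ : IsWienerMeasure i h μ) (u : H) : IsEll i μ u (ell i μ u) := by
  have := exists_isEll hi hd hμ u
  rw [ell, dif_pos this]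
  exact this.choose_spec

end Functionals

end WienerWeyl

namespace WienerWeyl

/-! ### Stochastic extension of coordinatewise Lipschitz functions. -/

section Extension

variable {H B J : Type*} [NormedAddCommGroup H] [InnerProductSpace ℝ H]
  [NormedAddCommGroup B] [NormedSpace ℝ B] {i : H →L[ℝ] B} {h : ℝ}

/-- `F` is Lipschitz with constant `δ j` in the direction `w j`, summed over all directions. -/
def IsCoordLipschitz (w : J → H) (δ : J → ℝ≥0∞) (F : H → ℂ) : Prop :=
  ∀ X Y, ‖F X - F Y‖ₑ ≤ ∑' j, δ j * ‖inner ℝ (w j) (X - Y)‖ₑ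

lemma norm_sub_le_of_hasLineDerivAt {F F' : H → ℂ} {v : H} {C : ℝ}
    (hF : ∀ X, HasLineDerivAt ℝ F (F' X) X v) (hC : ∀ X, ‖F' X‖ ≤ C) (X : H) (t : ℝ) :
    ‖F (X + t • v) - F X‖ ≤ C * |t| := by
  have hd : ∀ s : ℝ, HasDerivAt (fun s : ℝ => F (X + s • v)) (F' (X + s • v)) s := fun s => by
    have h1 : HasDerivAt (fun r : ℝ => F ((X + s • v) + r • v)) (F' (X + s • v)) 0 :=
      hF (X + s • v)
    -- A line derivative is a derivative at parameter 0; writing 0 as `s - s` lets a translation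
    -- turn it into a derivative at `s`.
    have h2 : HasDerivAt (fun r : ℝ => F ((X + s • v) + r • v)) (F' (X + s • v)) (s - s) := by
      simpa using h1
    have h3 := HasDerivAt.comp_sub_const s s h2
    refine h3.congr_of_eventuallyEq (Eventually.of_forall fun r => ?_)
    simp only [sub_smul]
    congr 1
    abel
  have := Convex.norm_image_sub_le_of_norm_hasDerivWithin_le (C := C)
    (fun s (_ : s ∈ Set.univ) => (hd s).hasDerivWithinAt) (fun s _ => hC _)
    convex_univ (Set.mem_univ 0) (Set.mem_univ t)
  simpa using this

/-- Moving along finitely many `w j` in turn costs the sum of the one-direction bounds. Continuity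
of `F` then handles the full expansion of `X - Y`, so no Fréchet differentiability is required. -/
lemma isCoordLipschitz_of_hasLineDerivAt {w : J → H} {δ : J → ℝ} {F : H → ℂ}
    {F' : J → H → ℂ} (hw : ∀ X, HasSum (fun j => inner ℝ (w j) X • w j) X)
    (hc : Continuous F) (hF : ∀ j X, HasLineDerivAt ℝ F (F' j X) X (w j))
    (hδ : ∀ j X, ‖F' j X‖ ≤ δ j) : IsCoordLipschitz w (fun j => ENNReal.ofReal (δ j)) F := by
  classical
  intro X Y
  have hfin : ∀ (s : Finset J) (c : J → ℝ) (Z : H),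
      ‖F (Z + ∑ j ∈ s, c j • w j) - F Z‖ₑ ≤ ∑ j ∈ s, ENNReal.ofReal (δ j) * ‖c j‖ₑ := by
    intro s c
    induction s using Finset.induction_on with
    | empty => simp
    | insert a s ha ih =>
      intro Z
      rw [Finset.sum_insert ha, Finset.sum_insert ha, ← add_assoc]
      have e : F (Z + c a • w a + ∑ j ∈ s, c j • w j) - F Z =
        (F (Z + c a • w a) - F Z) +
          (F (Z + c a • w a + ∑ j ∈ s, c j • w j) - F (Z + c a • w a)) := by ring
      rw [e]
      refine (enorm_add_le _ _).trans (add_le_add ?_ (ih _))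
      have h0 : 0 ≤ δ a := (norm_nonneg _).trans (hδ a Z)
      rw [← ofReal_norm, ← ofReal_norm, ← ENNReal.ofReal_mul h0]
      exact ENNReal.ofReal_le_ofReal (norm_sub_le_of_hasLineDerivAt (hF a) (hδ a) Z (c a))
  have hlim : Tendsto (fun s : Finset J => ‖F (Y + ∑ j ∈ s, inner ℝ (w j) (X - Y) • w j) - F Y‖ₑ)
      atTop (𝓝 ‖F X - F Y‖ₑ) := by
    have h1 : Tendsto (fun s : Finset J => Y + ∑ j ∈ s, inner ℝ (w j) (X - Y) • w j)
        atTop (𝓝 X) := by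
      simpa using (hw (X - Y)).const_add Y
    exact ((((hc.tendsto X).comp h1).sub_const (F Y)).enorm)
  exact le_of_tendsto' hlim fun s => (hfin s _ Y).trans (ENNReal.sum_le_tsum s)

variable [MeasurableSpace B] {μ : Measure B}

/-- `P` is a random element of `H` whose components along the `w j` are versions of `ℓ_{A j}`. -/
structure IsApproximant (i : H →L[ℝ] B) (μ : Measure B) (w A : J → H) (P : B → H) : Prop where
  aestronglyMeasurable : AEStronglyMeasurable P μ
  isEll : ∀ j, IsEll i μ (A j) (fun x => inner ℝ (w j) (P x))

/-- The size of the error `A j - w j`, weighted by `δ`. -/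
def weightedError (δ : J → ℝ≥0∞) (w A : J → H) : ℝ≥0∞ := ∑' j, δ j * ‖A j - w j‖ₑ

/-- Dominated convergence for series, with dominating family `δ j * C`; this is where summability of
`ε` enters. -/
lemma tendsto_weightedError {δ : J → ℝ} (hδ0 : ∀ j, 0 ≤ δ j) (hδ : Summable δ) {w : J → H}
    {A : ℕ → J → H} {C : ℝ} (hC : ∀ n j, ‖A n j - w j‖ ≤ C)
    (hA : ∀ j, Tendsto (fun n => A n j) atTop (𝓝 (w j))) :
    Tendsto (fun n => weightedError (fun j => ENNReal.ofReal (δ j)) w (A n)) atTop (𝓝 0) := by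
  have hb : ∀ n j, ‖δ j * ‖A n j - w j‖‖ ≤ δ j * C := fun n j => by
    rw [Real.norm_of_nonneg (mul_nonneg (hδ0 j) (norm_nonneg _))]
    exact mul_le_mul_of_nonneg_left (hC n j) (hδ0 j)
  have e : ∀ n, weightedError (fun j => ENNReal.ofReal (δ j)) w (A n) =
      ENNReal.ofReal (∑' j, δ j * ‖A n j - w j‖) := fun n => by
    rw [ENNReal.ofReal_tsum_of_nonneg (fun j => mul_nonneg (hδ0 j) (norm_nonneg _))
      (Summable.of_norm_bounded (hδ.mul_right C) (hb n))]
    simp_rw [weightedError, ENNReal.ofReal_mul (hδ0 _), ofReal_norm]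
  simp_rw [e]
  have := tendsto_tsum_of_dominated_convergence (𝓕 := atTop) (f := fun n j => δ j * ‖A n j - w j‖)
    (g := fun j => δ j * ‖w j - w j‖) (hδ.mul_right C)
    (fun j => (((hA j).sub_const (w j)).norm.const_mul (δ j))) (Eventually.of_forall hb)
  simpa using ENNReal.tendsto_ofReal this

/-- Linearity of `u ↦ ℓ_u`: the component along `w j` is `∑ (w_j · u_k) ℓ_{u_k}`, and `∑ (w_j · u_k)
u_k` is the projection of `w j`. -/
lemma isApproximant_piTilde [CompleteSpace H] [BorelSpace B] (hi : Function.Injective i)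
    (hd : DenseRange i) (hμ : IsWienerMeasure i h μ) (w : J → H) (E : Submodule ℝ H)
    [FiniteDimensional ℝ E] :
    IsApproximant i μ w (fun j => E.starProjection (w j)) (piTilde i μ E) := by
  refine ⟨?_, fun j => ?_⟩
  · unfold piTilde
    refine Finset.aestronglyMeasurable_fun_sum _ fun k _ => ?_
    exact (isEll_ell hi hd hμ _).1.1.smul_const _
  · have := IsEll.sum Finset.univ (fun k => (isEll_ell hi hd hμ
      (stdOrthonormalBasis ℝ E k : H)).smul (inner ℝ (w j) (stdOrthonormalBasis ℝ E k : H)))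
    convert this using 1
    · rw [Submodule.starProjection_apply,
        ← (stdOrthonormalBasis ℝ E).sum_repr (E.orthogonalProjectionOnto (w j))]
      simp only [Submodule.coe_sum, Submodule.coe_smul]
      refine Finset.sum_congr rfl fun k _ => ?_
      congr 1
      rw [OrthonormalBasis.repr_apply_apply, Submodule.inner_orthogonalProjectionOnto_eq_of_mem_left,
        real_inner_comm]
    · ext x
      simp [piTilde, inner_sum, inner_smul_right, mul_comm]

variable {w A A' : J → H} {P P' : B → H} {F : H → ℂ}

/-- Integrate the Lipschitz bound termwise, bound each L¹ norm by the L² norm of `ℓ_{A j - A' j}`,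
and compare `A j` and `A' j` through `w j`. -/
lemma eLpNorm_comp_sub_comp_le [BorelSpace B] [Countable J] {δ : J → ℝ≥0∞} (hd : DenseRange i)
    (hμ : IsWienerMeasure i h μ) (hF : IsCoordLipschitz w δ F)
    (hP : IsApproximant i μ w A P) (hP' : IsApproximant i μ w A' P') :
    eLpNorm (fun x => F (P x) - F (P' x)) 1 μ ≤
      (weightedError δ w A + weightedError δ w A') * gaussianNorm h := by
  have := hμ.isProbabilityMeasure
  have hell := fun j => (hP.isEll j).sub (hP'.isEll j)
  rw [eLpNorm_one_eq_lintegral_enorm]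
  calc ∫⁻ x, ‖F (P x) - F (P' x)‖ₑ ∂μ
      ≤ ∫⁻ x, ∑' j, δ j * ‖inner ℝ (w j) (P x) - inner ℝ (w j) (P' x)‖ₑ ∂μ :=
        lintegral_mono fun x => by simpa [inner_sub_right] using hF (P x) (P' x)
    _ = ∑' j, δ j * eLpNorm (fun x => inner ℝ (w j) (P x) - inner ℝ (w j) (P' x)) 1 μ := by
        rw [lintegral_tsum fun j => (hell j).1.1.enorm.const_mul _]
        congr 1 with j
        rw [lintegral_const_mul'' _ (hell j).1.1.enorm, eLpNorm_one_eq_lintegral_enorm]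
    _ ≤ ∑' j, (δ j * ‖A j - w j‖ₑ + δ j * ‖A' j - w j‖ₑ) * gaussianNorm h := by
        refine ENNReal.tsum_le_tsum fun j => ?_
        rw [← mul_add, mul_assoc]
        gcongr
        refine (eLpNorm_le_eLpNorm_of_exponent_le (q := 2) (by norm_num) (hell j).1.1).trans ?_
        rw [(hell j).eLpNorm_eq hμ hd]
        gcongr
        rw [← sub_sub_sub_cancel_right _ _ (w j)]
        exact enorm_sub_le
    _ = _ := by
        rw [ENNReal.tsum_mul_right, ENNReal.tsum_add]
        rfl

/-- A coordinatewise Lipschitz function with summable constants has a common stochastic extension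
in `L¹` with respect to two given Wiener measures. -/
theorem exists_isStochasticExtensionLp [CompleteSpace H] [BorelSpace B] [Countable J]
    (hi : Function.Injective i) (hd : DenseRange i) {h₁ h₂ : ℝ} {μ₁ μ₂ : Measure B}
    (hμ₁ : IsWienerMeasure i h₁ μ₁) (hμ₂ : IsWienerMeasure i h₂ μ₂) (hw : Orthonormal ℝ w)
    {δ : J → ℝ} (hδ0 : ∀ j, 0 ≤ δ j) (hδ : Summable δ) (hc : Continuous F) {K : ℝ}
    (hK : ∀ X, ‖F X‖ ≤ K) (hF : IsCoordLipschitz w (fun j => ENNReal.ofReal (δ j)) F) :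
    ∃ F' : B → ℂ, Measurable F' ∧ IsStochasticExtensionLp 1 i μ₁ F F' ∧
      IsStochasticExtensionLp 1 i μ₂ F F' := by
  classical
  have hp₁ := hμ₁.isProbabilityMeasure
  have hp₂ := hμ₂.isProbabilityMeasure
  have hex : ∀ (n : ℕ) (j : J), ∃ (a : H) (f : B →L[ℝ] ℝ), Represents i f a ∧
      ‖a - w j‖ ≤ 1 / ((n : ℝ) + 1) := fun n j => by
    obtain ⟨a, ha, f, hf⟩ := Metric.dense_iff.1 (dense_represents hi) (w j)
      (1 / ((n : ℝ) + 1)) Nat.one_div_pos_of_nat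
    exact ⟨a, f, hf, by simpa [dist_eq_norm] using (Metric.mem_ball.1 ha).le⟩
  choose a f hf ha using hex
  obtain ⟨S, hS⟩ := exists_seq_tendsto (atTop : Filter (Finset J))
  -- Finite sums of true functionals, so `P n` is defined everywhere on `B` and does not depend on a
  -- measure.
  set P : ℕ → B → H := fun n x => ∑ j ∈ S n, f n j x • w j with hPdef
  set A : ℕ → J → H := fun n j => if j ∈ S n then a n j else 0 with hAdef
  set T : ℕ → ℝ≥0∞ := fun n => weightedError (fun j => ENNReal.ofReal (δ j)) w (A n) with hTdef
  have hT : Tendsto T atTop (𝓝 0) := by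
    -- Inside `S n` the error is at most `1 / (n + 1)`; outside, `A n j = 0` and the error is `‖w j‖
    -- = 1`.
    refine tendsto_weightedError (C := 1) hδ0 hδ (fun n j => ?_) fun j => ?_
    · by_cases hj : j ∈ S n
      · simp only [hAdef, if_pos hj]
        refine (ha n j).trans ?_
        rw [div_le_one (by positivity)]
        linarith [n.cast_nonneg (α := ℝ)]
      · simp [hAdef, if_neg hj, hw.1 j]
    · rw [tendsto_iff_norm_sub_tendsto_zero]
      refine squeeze_zero' (Eventually.of_forall fun _ => norm_nonneg _) ?_
        tendsto_one_div_add_atTop_nhds_zero_nat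
      filter_upwards [hS.eventually (eventually_ge_atTop {j})] with n hn
      simp only [hAdef, if_pos (hn (Finset.mem_singleton_self j))]
      exact ha n j
  have hP : ∀ {h : ℝ} {μ : Measure B}, IsWienerMeasure i h μ → ∀ n,
      IsApproximant i μ w (A n) (P n) := by
    intro h μ hμ n
    refine ⟨?_, fun j => ?_⟩
    · refine Finset.aestronglyMeasurable_fun_sum _ fun k _ => ?_
      exact (hμ.memLp hd (hf n k)).1.smul_const _
    · have e : ∀ x, inner ℝ (w j) (P n x) = if j ∈ S n then f n j x else 0 := fun x => by
        simp only [hPdef, inner_sum, inner_smul_right, orthonormal_iff_ite.1 hw]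
        simp
      simp only [e]
      by_cases hj : j ∈ S n
      · simpa only [hAdef, if_pos hj] using (hf n j).isEll hμ hd
      · simpa only [hAdef, if_neg hj] using isEll_zero
  have hmeas : ∀ n, Continuous fun x => F (P n x) := fun n => by
    simp only [hPdef]
    fun_prop
  -- Working in L¹ of `μ₁ + μ₂` yields one limit valid for both measures, each being dominated by
  -- the sum.
  have hmem : ∀ n, MemLp (fun x => F (P n x)) 1 (μ₁ + μ₂) := fun n =>
    MemLp.of_bound (hmeas n).measurable.aestronglyMeasurable K (Eventually.of_forall fun x => hK _)
  set C : ℝ≥0∞ := gaussianNorm h₁ + gaussianNorm h₂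
  have hC : C ≠ ∞ := ENNReal.add_ne_top.2 ⟨gaussianNorm_ne_top _, gaussianNorm_ne_top _⟩
  have hcauchy : CauchySeq fun n => (hmem n).toLp := by
    rw [EMetric.cauchySeq_iff]
    intro r hr
    have hT' : Tendsto (fun p : ℕ × ℕ => (T p.1 + T p.2) * C) atTop (𝓝 0) := by
      rw [← prod_atTop_atTop_eq]
      simpa using ENNReal.Tendsto.mul_const
        ((hT.comp tendsto_fst).add (hT.comp tendsto_snd)) (Or.inr hC)
    obtain ⟨⟨N, N'⟩, hN⟩ := eventually_atTop.1 (hT'.eventually (gt_mem_nhds hr))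
    refine ⟨max N N', fun n hn m hm => lt_of_le_of_lt ?_
      (hN (n, m) ⟨(le_max_left _ _).trans hn, (le_max_right _ _).trans hm⟩)⟩
    rw [Lp.edist_toLp_toLp, eLpNorm_one_add_measure, mul_add]
    exact add_le_add (eLpNorm_comp_sub_comp_le hd hμ₁ hF (hP hμ₁ n) (hP hμ₁ m))
      (eLpNorm_comp_sub_comp_le hd hμ₂ hF (hP hμ₂ n) (hP hμ₂ m))
  obtain ⟨F', hF'⟩ := cauchySeq_tendsto_of_complete hcauchy
  have hlim : Tendsto (fun n => eLpNorm (fun x => F (P n x) - F' x) 1 (μ₁ + μ₂)) atTop (𝓝 0) := by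
    refine (Lp.tendsto_Lp_iff_tendsto_eLpNorm'' _ hmem F' (Lp.memLp F')).1 ?_
    simpa using hF'
  refine ⟨F', (Lp.stronglyMeasurable F').measurable, ?_⟩
  have key : ∀ {h : ℝ} {μ : Measure B}, IsWienerMeasure i h μ → μ ≤ μ₁ + μ₂ →
      IsStochasticExtensionLp 1 i μ F F' := by
    intro h μ hμ hle
    have hp := hμ.isProbabilityMeasure
    have hFmem : MemLp F' 1 μ := (Lp.memLp F').mono_measure hle
    refine ⟨hFmem, fun E _ hmono hdense => ?_⟩
    have hPE := fun n => isApproximant_piTilde hi hd hμ w (E n)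
    have hEm : ∀ n, MemLp (fun x => F (piTilde i μ (E n) x)) 1 μ := fun n =>
      MemLp.of_bound (hc.comp_aestronglyMeasurable (hPE n).aestronglyMeasurable) K
        (Eventually.of_forall fun x => hK _)
    refine ⟨hEm, ?_⟩
    have hTE : Tendsto (fun n => weightedError (fun j => ENNReal.ofReal (δ j)) w
        (fun j => (E n).starProjection (w j))) atTop (𝓝 0) := by
      refine tendsto_weightedError (C := 2) hδ0 hδ (fun n j => ?_) fun j => ?_
      · refine (norm_sub_le _ _).trans ?_
        have := (E n).norm_starProjection_apply_le (w j)
        rw [hw.1 j] at this ⊢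
        linarith
      · refine Submodule.starProjection_tendsto_self E hmono (w j) ?_
        rw [top_le_iff, ← Submodule.dense_iff_topologicalClosure_eq_top]
        rwa [Submodule.coe_iSup_of_directed _ hmono.directed_le]
    have hlim' : Tendsto (fun n => eLpNorm (fun x => F (P n x) - F' x) 1 μ) atTop (𝓝 0) :=
      tendsto_of_tendsto_of_tendsto_of_le_of_le tendsto_const_nhds hlim (fun _ => zero_le)
        fun n => eLpNorm_mono_measure _ hle
    refine tendsto_of_tendsto_of_tendsto_of_le_of_le tendsto_const_nhds
      (by simpa using (ENNReal.Tendsto.mul_const (hTE.add hT)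
        (Or.inr (gaussianNorm_ne_top h))).add hlim') (fun _ => zero_le) fun n => ?_
    have e : (fun x => F (piTilde i μ (E n) x) - F' x) =
        (fun x => F (piTilde i μ (E n) x) - F (P n x)) + fun x => F (P n x) - F' x := by
      ext x; simp
    have hPn : AEStronglyMeasurable (fun x => F (P n x)) μ :=
      (hmeas n).measurable.aestronglyMeasurable
    simp only [e]
    exact (eLpNorm_add_le ((hEm n).1.sub hPn) (hPn.sub hFmem.1) le_rfl).trans
      (add_le_add_left (eLpNorm_comp_sub_comp_le hd hμ hF (hPE n) (hP hμ n)) _)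
  exact ⟨key hμ₁ (Measure.le_add_right le_rfl), key hμ₂ (Measure.le_add_left le_rfl)⟩

lemma IsStochasticExtensionLp.isStochasticExtension {F' : B → ℂ} (hc : Continuous F)
    (hm : Measurable F') (hF : IsStochasticExtensionLp 1 i μ F F') :
    IsStochasticExtension i μ F F' := by
  refine ⟨?_, hm, fun E _ hmono hdense => ?_⟩
  · borelize H
    exact hc.measurable
  · obtain ⟨h1, h2⟩ := hF.2 E hmono hdense
    exact tendstoInMeasure_of_tendsto_eLpNorm one_ne_zero (fun n => (h1 n).1) hF.1.1 h2

end Extension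

end WienerWeyl

namespace WienerWeyl

/-! ### Gross's theorem: existence of Wiener measures on `B` and `B²`. -/

section Existence

/-- Given finite-dimensional subspaces `K n`, a separable Hilbert space has a Hilbert basis made
of finite blocks, of which the block `n + 1` is orthogonal to `K n`. -/
lemma exists_hilbertBasis_blocks {H : Type*} [NormedAddCommGroup H] [InnerProductSpace ℝ H]
    [CompleteSpace H] [TopologicalSpace.SeparableSpace H] (K : ℕ → Submodule ℝ H)
    [∀ n, FiniteDimensional ℝ (K n)] :
    ∃ (d : ℕ → ℕ) (b : HilbertBasis (Σ n, Fin (d n)) ℝ H),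
      ∀ n l, b ⟨n + 1, l⟩ ∈ (K n)ᗮ := by
  set x := TopologicalSpace.denseSeq H
  -- The points `x m` of a dense sequence make the union of the `E n` dense; the `K m` give the
  -- orthogonality. The block `D n` is the complement of `E n` in `E (n + 1)`, so `D (n + 1)` is
  -- orthogonal to `E (n + 1)`, which contains `K n`.
  set E : ℕ → Submodule ℝ H := fun n =>
    (Finset.range n).sup fun m => K m ⊔ Submodule.span ℝ {x m} with hE
  have hEfin : ∀ n, FiniteDimensional ℝ (E n) := fun n =>
    inferInstanceAs (FiniteDimensional ℝ
      ((Finset.range n).sup fun m => K m ⊔ Submodule.span ℝ {x m} : Submodule ℝ H))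
  have hEmono : Monotone E := fun m n hmn =>
    Finset.sup_mono (Finset.range_subset_range.2 hmn)
  have hEle : ∀ n, K n ⊔ Submodule.span ℝ {x n} ≤ E (n + 1) := fun n =>
    Finset.le_sup (f := fun m => K m ⊔ Submodule.span ℝ {x m}) (Finset.self_mem_range_succ n)
  set D : ℕ → Submodule ℝ H := fun n => (E n)ᗮ ⊓ E (n + 1) with hD
  have hDfin : ∀ n, FiniteDimensional ℝ (D n) := fun n =>
    Submodule.finiteDimensional_of_le (inf_le_right : D n ≤ E (n + 1))
  have horth : OrthogonalFamily ℝ (fun n => D n) fun n => (D n).subtypeₗᵢ := by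
    have hlt : ∀ {m n : ℕ}, m < n → ∀ (v : D m) (w : D n), inner ℝ (v : H) (w : H) = 0 :=
      fun hmn v w => (Submodule.mem_orthogonal _ _).1 w.2.1 _ (hEmono hmn v.2.2)
    intro m n hmn v w
    rcases lt_or_gt_of_ne hmn with h | h
    · exact hlt h v w
    · rw [real_inner_comm]
      exact hlt h w v
  have hv := horth.orthonormal_sigma_orthonormal
    (v_family := fun n => (stdOrthonormalBasis ℝ (D n) : _ → D n))
    (fun n => (stdOrthonormalBasis ℝ (D n)).orthonormal)
  set v : (Σ n, Fin (Module.finrank ℝ (D n))) → H :=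
    fun a => (D a.1).subtypeₗᵢ (stdOrthonormalBasis ℝ (D a.1) a.2)
  have hDspan : ∀ n, D n ≤ Submodule.span ℝ (Set.range v) := fun n y hy => by
    have := congrArg (fun z : D n => (z : H)) ((stdOrthonormalBasis ℝ (D n)).sum_repr ⟨y, hy⟩)
    simp only [Submodule.coe_sum, Submodule.coe_smul] at this
    rw [← this]
    exact Submodule.sum_mem _ fun k _ => Submodule.smul_mem _ _
      (Submodule.subset_span ⟨⟨n, k⟩, rfl⟩)
  have hEspan : ∀ n, E n ≤ Submodule.span ℝ (Set.range v) := fun n => by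
    induction n with
    | zero => simp [hE]
    | succ n ih =>
      rw [← Submodule.sup_orthogonal_inf_of_hasOrthogonalProjection (hEmono n.le_succ)]
      exact sup_le ih (hDspan n)
  have hdense : ⊤ ≤ (Submodule.span ℝ (Set.range v)).topologicalClosure := by
    rw [top_le_iff, ← Submodule.dense_iff_topologicalClosure_eq_top]
    refine (TopologicalSpace.denseRange_denseSeq H).mono ?_
    rintro _ ⟨n, rfl⟩
    exact hEspan (n + 1) (hEle n (Submodule.mem_sup_right (Submodule.mem_span_singleton_self _)))
  refine ⟨fun n => Module.finrank ℝ (D n), HilbertBasis.mk hv hdense, fun n l => ?_⟩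
  rw [HilbertBasis.coe_mk]
  have hmem : (stdOrthonormalBasis ℝ (D (n + 1)) l : H) ∈ D (n + 1) := Subtype.coe_prop _
  exact Submodule.orthogonal_le (le_sup_left.trans (hEle n)) hmem.1

variable {H B : Type*} [NormedAddCommGroup H] [InnerProductSpace ℝ H]
  [NormedAddCommGroup B] [NormedSpace ℝ B] {i : H →L[ℝ] B} {h : ℝ}

lemma charFun_map_sum_mul_infinitePi_gaussianReal {J : Type*} [Countable J] (v : NNReal)
    (s : Finset J) (c : J → ℝ) :
    charFun ((Measure.infinitePi fun _ : J => gaussianReal 0 v).map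
      fun ω => ∑ j ∈ s, c j * ω j) 1 = Complex.exp (-(v * (∑ j ∈ s, c j ^ 2) / 2 : ℝ)) := by
  have hind := iIndepFun_infinitePi (P := fun _ : J => gaussianReal 0 v)
    (X := fun j (t : ℝ) => c j * t) (fun j => by fun_prop)
  have hind' : iIndepFun (s.restrict fun j (ω : J → ℝ) => c j * ω j)
      (Measure.infinitePi fun _ : J => gaussianReal 0 v) :=
    hind.precomp (g := fun j : s => (j : J)) Subtype.val_injective
  have h1 := congrFun (iIndepFun.charFun_map_fun_finsetSum_eq_prod
    (fun j _ => Measurable.aemeasurable (by fun_prop)) hind') 1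
  rw [h1, Finset.prod_apply]
  have h2 : ∀ j, charFun ((Measure.infinitePi fun _ : J => gaussianReal 0 v).map
      fun ω => c j * ω j) 1 = Complex.exp (-(v * c j ^ 2 / 2 : ℝ)) := fun j => by
    have : (fun ω : J → ℝ => c j * ω j) = (fun t => c j * t) ∘ fun ω => ω j := rfl
    rw [this, ← Measure.map_map (by fun_prop) (by fun_prop), Measure.infinitePi_map_eval,
      charFun_map_mul, charFun_gaussianReal]
    simp
  simp_rw [h2]
  rw [← Complex.exp_sum]
  congr 1
  push_cast
  rw [Finset.mul_sum, Finset.sum_div, Finset.sum_neg_distrib]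

lemma phaseIncl_apply (i : H →L[ℝ] B) (X : Phase H) : phaseIncl i X = (i X.fst, i X.snd) := rfl

lemma injective_phaseIncl (hi : Function.Injective i) : Function.Injective (phaseIncl i) :=
  (hi.prodMap hi).comp (WithLp.prodContinuousLinearEquiv 2 ℝ H H).injective

lemma denseRange_phaseIncl (hd : DenseRange i) : DenseRange (phaseIncl i) :=
  (hd.prodMap hd).comp (WithLp.prodContinuousLinearEquiv 2 ℝ H H).surjective.denseRange
    (i.prodMap i).continuous

variable [MeasurableSpace B] [BorelSpace B]

/-- Gross's theorem: an abstract Wiener space carries Wiener measures. -/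
theorem IsAbstractWienerSpace.exists_isWienerMeasure [CompleteSpace H]
    [TopologicalSpace.SeparableSpace H] [CompleteSpace B] (hi : IsAbstractWienerSpace i)
    (hh : 0 < h) : ∃ μ : Measure B, IsWienerMeasure i h μ := by
  have hr : ∀ n : ℕ, (0 : ℝ) < (1 / 2) ^ n := fun n => by positivity
  -- The same `2⁻ⁿ` bounds both the size of a block and the probability of exceeding it, so both
  -- series converge.
  choose K hKfin hK using fun n : ℕ => hi.measurable_norm ((1 / 2) ^ n) h (hr n) hh
  obtain ⟨d, b, hb⟩ := exists_hilbertBasis_blocks K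
  set Q : Measure ((Σ n, Fin (d n)) → ℝ) :=
    Measure.infinitePi fun _ => gaussianReal 0 h.toNNReal with hQ
  set Y : ℕ → ((Σ n, Fin (d n)) → ℝ) → B := fun n ω => i (∑ l, ω ⟨n, l⟩ • b ⟨n, l⟩) with hY
  have hYc : ∀ n, Continuous (Y n) := fun n => by simp only [hY]; fun_prop
  have hinj : ∀ n, Function.Injective fun l : Fin (d n) => (⟨n, l⟩ : Σ n, Fin (d n)) :=
    fun n l m hlm => by simpa using hlm
  have hlaw : ∀ n, Q.map (fun ω (l : Fin (d n)) => ω ⟨n, l⟩) = gaussianFin (d n) h := fun n => by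
    rw [hQ, Measure.map_infinitePi_infinitePi_of_inj (hinj n), Measure.infinitePi_eq_pi]
    rfl
  have hsmall : ∀ n, Q {ω | (1 / 2) ^ n < ‖Y (n + 1) ω‖} ≤ ENNReal.ofReal ((1 / 2) ^ n) := by
    intro n
    have h1 := hK n (d (n + 1)) (fun l => b ⟨n + 1, l⟩)
      (b.orthonormal.comp _ (hinj (n + 1))) (fun l => hb n l)
    rw [← hlaw, Measure.map_apply (by fun_prop)
      (measurableSet_lt measurable_const (Continuous.measurable (by fun_prop)))] at h1
    exact h1.le
  -- Borel–Cantelli: almost surely `‖Y (n + 1)‖ ≤ 2⁻ⁿ` eventually. Block 0 is unconstrained, hence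
  -- the shift by one.
  have hsum : ∀ᵐ ω ∂Q, Summable fun n => Y n ω := by
    have hfin : ∑' n, Q {ω | (1 / 2) ^ n < ‖Y (n + 1) ω‖} ≠ ∞ := by
      refine ne_top_of_le_ne_top ?_ (ENNReal.tsum_le_tsum hsmall)
      rw [← ENNReal.ofReal_tsum_of_nonneg (fun n => (hr n).le) summable_geometric_two]
      exact ENNReal.ofReal_ne_top
    filter_upwards [ae_eventually_notMem hfin] with ω hω
    rw [← summable_nat_add_iff 1]
    refine Summable.of_norm_bounded_eventually_nat summable_geometric_two ?_
    filter_upwards [hω] with n hn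
    simpa using hn
  have hlim : ∀ᵐ ω ∂Q, Tendsto (fun n => ∑ k ∈ Finset.range n, Y k ω) atTop
      (𝓝 (∑' k, Y k ω)) := by
    filter_upwards [hsum] with ω hω using hω.hasSum.tendsto_sum_nat
  have hSc : ∀ n, Continuous fun ω => ∑ k ∈ Finset.range n, Y k ω := fun n => by fun_prop
  have hX : AEMeasurable (fun ω => ∑' k, Y k ω) Q :=
    aemeasurable_of_tendsto_metrizable_ae atTop (fun n => (hSc n).measurable.aemeasurable) hlim
  have := Measure.isProbabilityMeasure_map hX
  refine ⟨Q.map fun ω => ∑' k, Y k ω, isWienerMeasure_of_map_eq fun f u hf => ?_⟩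
  set s : ℕ → Finset (Σ n, Fin (d n)) := fun n => (Finset.range n).sigma fun _ => Finset.univ
    with hs
  have hfS : ∀ n ω, f (∑ k ∈ Finset.range n, Y k ω) = ∑ j ∈ s n, inner ℝ u (b j) * ω j := by
    intro n ω
    rw [hs, Finset.sum_sigma]
    simp [hY, hf _, mul_comm]
  have hsatTop : Tendsto s atTop atTop := by
    refine tendsto_atTop_finset_of_monotone (fun m n hmn => ?_) fun a => ⟨a.1 + 1, by simp [hs]⟩
    exact Finset.sigma_mono (Finset.range_subset_range.2 hmn) fun _ => le_rfl
  have hint : ∀ g : ((Σ n, Fin (d n)) → ℝ) → ℝ, AEMeasurable g Q →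
      charFun (Q.map g) 1 = ∫ ω, Complex.exp (g ω * Complex.I) ∂Q := fun g hg => by
    rw [charFun_apply_real, integral_map hg (Measurable.aestronglyMeasurable (by fun_prop))]
    simp
  have hmap : (Q.map fun ω => ∑' k, Y k ω).map f = Q.map fun ω => f (∑' k, Y k ω) :=
    AEMeasurable.map_map_of_aemeasurable f.continuous.measurable.aemeasurable hX
  rw [hmap, hint (fun ω => f (∑' k, Y k ω)) (f.continuous.measurable.comp_aemeasurable hX)]
  -- The characteristic function of the limit is the limit of those of the partial sums, which are
  -- explicit; by Parseval their variances tend to `h * ‖u‖ ^ 2`.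
  have hl1 : Tendsto (fun n => ∫ ω, Complex.exp (f (∑ k ∈ Finset.range n, Y k ω) * Complex.I) ∂Q)
      atTop (𝓝 (∫ ω, Complex.exp (f (∑' k, Y k ω) * Complex.I) ∂Q)) := by
    refine tendsto_integral_of_dominated_convergence (fun _ => 1) (fun n => ?_)
      (integrable_const 1) (fun n => ?_) ?_
    · refine Measurable.aestronglyMeasurable (Continuous.measurable ?_)
      have := hSc n
      fun_prop
    · exact Eventually.of_forall fun ω => (Complex.norm_exp_ofReal_mul_I _).le
    · filter_upwards [hlim] with ω hω
      have hcont : Continuous fun y : B => Complex.exp (f y * Complex.I) := by fun_prop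
      exact (hcont.tendsto _).comp hω
  refine tendsto_nhds_unique hl1 ?_
  have hval : ∀ n, ∫ ω, Complex.exp (f (∑ k ∈ Finset.range n, Y k ω) * Complex.I) ∂Q =
      Complex.exp (-(h.toNNReal * (∑ j ∈ s n, inner ℝ u (b j) ^ 2) / 2 : ℝ)) := fun n => by
    simp_rw [hfS]
    rw [← charFun_map_sum_mul_infinitePi_gaussianReal,
      hint _ (Measurable.aemeasurable (by fun_prop))]
  simp_rw [hval]
  have hpars : HasSum (fun j => inner ℝ u (b j) ^ 2) (‖u‖ ^ 2) := by
    have := b.hasSum_inner_mul_inner u u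
    rw [real_inner_self_eq_norm_sq] at this
    simpa [sq, real_inner_comm u] using this
  have hlim2 := hpars.comp hsatTop
  have hcont : Continuous fun r : ℝ => Complex.exp (-(h.toNNReal * r / 2 : ℝ)) := by fun_prop
  exact (hcont.tendsto _).comp hlim2

lemma IsWienerMeasure.charFunDual_eq {μ : Measure B} (hμ : IsWienerMeasure i h μ)
    (hd : DenseRange i) {f : B →L[ℝ] ℝ} {u : H} (hf : Represents i f u) :
    charFunDual μ f = Complex.exp (-(h.toNNReal * ‖u‖ ^ 2 / 2 : ℝ)) := by
  rw [charFunDual_eq_charFun_map_one, hμ.map_eq_gaussianReal hd hf, charFun_map_mul,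
    charFun_gaussianReal]
  simp

/-- The square of a Wiener measure on `B` is a Wiener measure on `B²`. -/
lemma IsWienerMeasure.prod [SecondCountableTopology B] {μ : Measure B}
    (hμ : IsWienerMeasure i h μ) (hd : DenseRange i) :
    IsWienerMeasure (phaseIncl i) h (μ.prod μ) := by
  have := hμ.isProbabilityMeasure
  refine isWienerMeasure_of_map_eq fun f U hf => ?_
  have h1 : Represents i (f.comp (ContinuousLinearMap.inl ℝ B B)) U.fst := fun x => by
    simpa [phaseIncl_apply, WithLp.prod_inner_apply] using hf (WithLp.toLp 2 (x, 0))
  have h2 : Represents i (f.comp (ContinuousLinearMap.inr ℝ B B)) U.snd := fun x => by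
    simpa [phaseIncl_apply, WithLp.prod_inner_apply] using hf (WithLp.toLp 2 (0, x))
  rw [← charFunDual_eq_charFun_map_one, charFunDual_prod, hμ.charFunDual_eq hd h1,
    hμ.charFunDual_eq hd h2, ← Complex.exp_add, WithLp.prod_norm_sq_eq_of_L2]
  congr 1
  push_cast
  ring

lemma isWienerMeasure_wienerMeasure [CompleteSpace H] [TopologicalSpace.SeparableSpace H]
    [CompleteSpace B] [SecondCountableTopology B] (hi : IsAbstractWienerSpace i) (hh : 0 < h) :
    IsWienerMeasure (phaseIncl i) h (wienerMeasure (phaseIncl i) h) := by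
  obtain ⟨μ, hμ⟩ := hi.exists_isWienerMeasure hh
  have hex : ∃ ν : Measure (B × B), IsWienerMeasure (phaseIncl i) h ν :=
    ⟨_, hμ.prod hi.denseRange⟩
  rw [wienerMeasure, dif_pos hex]
  exact hex.choose_spec

end Existence

/-! ### The basis of `H²` and the class `S_m`. -/

section PhaseSpace

variable {H Γ : Type*} [NormedAddCommGroup H] [InnerProductSpace ℝ H]

/-- The Hilbert basis `(u_j), (v_j)` of `H²`. -/
def phaseBasis (e : HilbertBasis Γ ℝ H) : Γ ⊕ Γ → Phase H :=
  Sum.elim (fun j => WithLp.toLp 2 (e j, 0)) (fun j => WithLp.toLp 2 (0, e j))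

lemma orthonormal_phaseBasis (e : HilbertBasis Γ ℝ H) : Orthonormal ℝ (phaseBasis e) := by
  classical
  rw [orthonormal_iff_ite]
  rintro (j | j) (k | k) <;>
    simp [phaseBasis, WithLp.prod_inner_apply, orthonormal_iff_ite.1 e.orthonormal]

lemma hasSum_phaseBasis (e : HilbertBasis Γ ℝ H) (X : Phase H) :
    HasSum (fun j => inner ℝ (phaseBasis e j) X • phaseBasis e j) X := by
  let L := (WithLp.prodContinuousLinearEquiv 2 ℝ H H).symm.toContinuousLinearMap
  have h1 := (e.hasSum_repr X.fst).mapL (L.comp (ContinuousLinearMap.inl ℝ H H))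
  have h2 := (e.hasSum_repr X.snd).mapL (L.comp (ContinuousLinearMap.inr ℝ H H))
  have h3 : X = (L.comp (ContinuousLinearMap.inl ℝ H H)) X.fst +
      (L.comp (ContinuousLinearMap.inr ℝ H H)) X.snd := by
    refine WithLp.ofLp_injective 2 ?_
    ext <;> simp [L]
  nth_rw 2 [h3]
  refine HasSum.sum ?_ ?_
  · convert h1 using 2 with j
    simp [phaseBasis, WithLp.prod_inner_apply, e.repr_apply_apply, L]
  · convert h2 using 2 with j
    simp [phaseBasis, WithLp.prod_inner_apply, e.repr_apply_apply, L]

lemma InSClass.mono {e : HilbertBasis Γ ℝ H} {m n : ℕ} (hmn : m ≤ n) {M : ℝ} {ε : Γ → ℝ}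
    {F : Phase H → ℂ} (hF : InSClass e n M ε F) : InSClass e m M ε F := by
  obtain ⟨h1, h2, h3, h4, D, h5, h6, h7, h8⟩ := hF
  exact ⟨h1, h2, h3, h4, D, h5,
    fun α β hα hβ => h6 α β (fun j => (hα j).trans hmn) fun j => (hβ j).trans hmn,
    fun α β l hα hβ hl => h7 α β l (fun j => (hα j).trans hmn) (fun j => (hβ j).trans hmn)
      (hl.trans_le hmn),
    fun α β l hα hβ hl => h8 α β l (fun j => (hα j).trans hmn) (fun j => (hβ j).trans hmn)
      (hl.trans_le hmn)⟩

/-- Only the derivatives with a single first-order factor are used; their bounds are `M * ε l`. -/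
lemma InSClass.isCoordLipschitz {e : HilbertBasis Γ ℝ H} {M : ℝ} {ε : Γ → ℝ} {F : Phase H → ℂ}
    (hF : InSClass e 1 M ε F) : IsCoordLipschitz (phaseBasis e)
      (fun j => ENNReal.ofReal (Sum.elim (fun j => M * ε j) (fun j => M * ε j) j)) F := by
  classical
  obtain ⟨D, h0, hb, hu, hv⟩ := hF.derivatives
  have hs : ∀ l j : Γ, Finsupp.single l 1 j ≤ 1 := fun l j => by
    rw [Finsupp.single_apply]; split_ifs <;> simp
  have hz : ∀ j : Γ, (0 : Γ →₀ ℕ) j ≤ 1 := fun j => by simp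
  refine isCoordLipschitz_of_hasLineDerivAt
    (F' := Sum.elim (fun l => D (Finsupp.single l 1) 0) (fun l => D 0 (Finsupp.single l 1)))
    (hasSum_phaseBasis e) hF.continuous ?_ ?_
  · rintro (l | l) X
    · have := hu 0 0 l hz hz (by simp) X
      rwa [h0, zero_add] at this
    · have := hv 0 0 l hz hz (by simp) X
      rwa [h0, zero_add] at this
  · rintro (l | l) X
    · simpa using (hb _ 0 (hs l) hz).2 X
    · simpa using (hb 0 _ hz (hs l)).2 X

end PhaseSpace

end WienerWeyl

/-! ### Conclusion on phase space. -/

open WienerWeyl in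
/-- A function in `S_1(M, ε)` with `ε` summable has a common stochastic extension in `L¹` with
respect to the Wiener measures of two given parameters. -/
theorem WienerWeyl.InSClass.exists_isStochasticExtensionLp {H B Γ : Type*}
    [NormedAddCommGroup H] [InnerProductSpace ℝ H] [CompleteSpace H]
    [TopologicalSpace.SeparableSpace H]
    [NormedAddCommGroup B] [NormedSpace ℝ B] [CompleteSpace B]
    [MeasurableSpace B] [BorelSpace B] [Countable Γ]
    {i : H →L[ℝ] B} (hi : IsAbstractWienerSpace i)
    {e : HilbertBasis Γ ℝ H} {M : ℝ} {ε : Γ → ℝ} (hε : Summable ε)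
    {F : Phase H → ℂ} (hF : InSClass e 1 M ε F) {h₁ h₂ : ℝ} (hh₁ : 0 < h₁) (hh₂ : 0 < h₂) :
    ∃ F' : B × B → ℂ, Measurable F' ∧
      IsStochasticExtensionLp 1 (phaseIncl i) (wienerMeasure (phaseIncl i) h₁) F F' ∧
      IsStochasticExtensionLp 1 (phaseIncl i) (wienerMeasure (phaseIncl i) h₂) F F' := by
  -- `B` inherits separability from `H` through the dense range, so the Borel σ-algebra of `B²` is
  -- the product one.
  have : TopologicalSpace.SeparableSpace B := hi.denseRange.separableSpace i.continuous
  have : SecondCountableTopology B := UniformSpace.secondCountable_of_separable B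
  obtain ⟨K, hK⟩ := hF.bounded
  refine WienerWeyl.exists_isStochasticExtensionLp (injective_phaseIncl hi.injective)
    (denseRange_phaseIncl hi.denseRange) (isWienerMeasure_wienerMeasure hi hh₁)
    (isWienerMeasure_wienerMeasure hi hh₂) (orthonormal_phaseBasis e) ?_ ?_ hF.continuous hK
    hF.isCoordLipschitz
  · rintro (j | j) <;> exact mul_nonneg hF.M_nonneg (hF.ε_nonneg j)
  · exact Summable.sum _ (hε.mul_left M) (hε.mul_left M)

theorem proposition8p7 {H B Γ : Type*}
    [NormedAddCommGroup H] [InnerProductSpace ℝ H] [CompleteSpace H]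
    [TopologicalSpace.SeparableSpace H]
    [NormedAddCommGroup B] [NormedSpace ℝ B] [CompleteSpace B]
    [MeasurableSpace B] [BorelSpace B] [Countable Γ]
    (i : H →L[ℝ] B) (hi : WienerWeyl.IsAbstractWienerSpace i)
    (e : HilbertBasis Γ ℝ H) (M : ℝ) (ε : Γ → ℝ) (hε : Summable ε)
    (F : WienerWeyl.Phase H → ℂ) :
    (WienerWeyl.InSClass e 1 M ε F →
      (∀ h : ℝ, 0 < h → ∃ F' : B × B → ℂ,
        WienerWeyl.IsStochasticExtensionLp 1 (WienerWeyl.phaseIncl i)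
          (WienerWeyl.wienerMeasure (WienerWeyl.phaseIncl i) h) F F') ∧
      (∀ h : ℝ, 0 < h → WienerWeyl.HypothesisH2 i h F)) ∧
    (WienerWeyl.HypothesisH1 e M ε F →
      ∀ h : ℝ, 0 < h → WienerWeyl.HypothesisH2 i h F) := by
  have hH2 : WienerWeyl.InSClass e 1 M ε F →
      ∀ h : ℝ, 0 < h → WienerWeyl.HypothesisH2 i h F := fun hF h hh => by
    obtain ⟨F', hm, h1, h2⟩ := hF.exists_isStochasticExtensionLp hi hε hh (half_pos hh)
    exact ⟨F', h1.isStochasticExtension hF.continuous hm,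
      h2.isStochasticExtension hF.continuous hm⟩
  refine ⟨fun hF => ⟨fun h hh => ?_, hH2 hF⟩, fun hF => hH2 (hF.1.mono one_le_two)⟩
  obtain ⟨F', -, h1, -⟩ := hF.exists_isStochasticExtensionLp hi hε hh hh
  exact ⟨F', h1⟩

end
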